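/- Let $n \ge 0$ be an integer, let $\alpha_1, \dots, \alpha_n \in \mathbb{C}[t]$ be polynomials, and let $\alpha = (\alpha_1, \dots, \alpha_n) : \mathbb{C} \to \mathbb{C}^n$, $t \mapsto (\alpha_1(t), \dots, \alpha_n(t))$, be the polynomial map they define. Call $\alpha$ an embedding if $\alpha$ is injective and $\alpha'(t) \neq 0$ for every $t \in \mathbb{C}$. Let $\hat{\alpha} : \mathbb{C}[x_1, \dots, x_n] \to \mathbb{C}[t]$ be the homomorphism of $\mathbb{C}$-algebras determined by $\hat{\alpha}(x_i) = \alpha_i(t)$ for $i = 1, \dots, n$. Then $\alpha$ is an embedding if and only if $\hat{\alpha}$ is surjective. -/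

import Mathlib

namespace PolynomialKnot

/-- The polynomial map `ℂ → ℂⁿ`, `t ↦ (α₁(t), …, αₙ(t))`, with components `α i`. -/
def toMap {n : ℕ} (α : Fin n → Polynomial ℂ) : ℂ → (Fin n → ℂ) :=
  fun t i => (α i).eval t

/-- A polynomial map `ℂ → ℂⁿ` is an embedding if it is injective and its derivative vanishes
nowhere. (A polynomial map is differentiable everywhere, so `deriv` is the actual derivative.) -/
def IsEmbedding {n : ℕ} (α : Fin n → Polynomial ℂ) : Prop :=
  Function.Injective (toMap α) ∧ ∀ t : ℂ, deriv (toMap α) t ≠ 0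

/-- The induced map `ℂ[x₁, …, xₙ] → ℂ[t]` of `ℂ`-algebras, given by `xᵢ ↦ αᵢ(t)`. -/
noncomputable def hat {n : ℕ} (α : Fin n → Polynomial ℂ) :
    MvPolynomial (Fin n) ℂ →ₐ[ℂ] Polynomial ℂ :=
  MvPolynomial.aeval α

end PolynomialKnot

open Polynomial

namespace PolynomialKnot

variable {n : ℕ}

/-! If `hat α` is onto, a preimage of `X` is a polynomial left inverse of α. Conversely, let A be
the range of `hat α`; ℂ[t] is finite over A. Injectivity and α' ≠ 0 put t - a in the extension of
the ideal of A vanishing at a. So A and that extension span ℂ[t], and Nakayama shows that the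
conductor of A lies in no maximal ideal, hence A = ℂ[t]. -/

theorem deriv_toMap (α : Fin n → ℂ[X]) (t : ℂ) :
    deriv (toMap α) t = fun i => (derivative (α i)).eval t := by
  have h : HasDerivAt (toMap α) (fun i => (derivative (α i)).eval t) t :=
    hasDerivAt_pi.2 fun i => (α i).hasDerivAt t
  exact h.deriv

theorem injective_toMap_of_surjective_hat {α : Fin n → ℂ[X]}
    (h : Function.Surjective (hat α)) : Function.Injective (toMap α) := by
  obtain ⟨p, hp⟩ := h X
  have key (t : ℂ) : MvPolynomial.aeval (toMap α t) p = t := by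
    have := congrArg (aeval t) hp
    rw [hat, aeval_X, ← AlgHom.comp_apply, MvPolynomial.comp_aeval] at this
    simpa [coe_aeval_eq_eval, show toMap α t = fun i => (α i).eval t from rfl] using this
  intro s t hst
  rw [← key s, hst, key t]

/-- By the chain rule, a zero of α' is a critical point of everything in the range, but `X` has
derivative 1. -/
theorem deriv_toMap_ne_zero_of_surjective_hat {α : Fin n → ℂ[X]}
    (h : Function.Surjective (hat α)) (t : ℂ) : deriv (toMap α) t ≠ 0 := by
  intro h0
  rw [deriv_toMap] at h0
  have key (p : MvPolynomial (Fin n) ℂ) : (derivative (hat α p)).eval t = 0 := by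
    induction p using MvPolynomial.induction_on with
    | C c => simp [hat]
    | add p q hp hq => simp [hp, hq]
    | mul_X p i hp =>
      have hi : (derivative (α i)).eval t = 0 := congrFun h0 i
      have hX : hat α (MvPolynomial.X i) = α i := by simp [hat]
      simp [derivative_mul, hp, hX, hi]
  obtain ⟨p, hp⟩ := h X
  simpa [hp] using key p

/-- A polynomial whose only possible root is `a`, with multiplicity at most one,
divides `X - a`. -/
theorem dvd_X_sub_C_of_roots {K : Type*} [Field K] [IsAlgClosed K] {g : K[X]} {a : K}
    (hroot : ∀ b, g.IsRoot b → b = a) (hsq : ¬ (X - C a) ^ 2 ∣ g) : g ∣ X - C a := by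
  have hg : g ≠ 0 := fun h => hsq (h ▸ dvd_zero _)
  by_cases hd : g.degree = 0
  · exact (isUnit_iff_degree_eq_zero.2 hd).dvd
  obtain ⟨b, hb⟩ := IsAlgClosed.exists_root g hd
  obtain rfl := hroot b hb
  obtain ⟨k, rfl⟩ := dvd_iff_isRoot.2 hb
  have hk : k.degree = 0 := by
    by_contra hk
    obtain ⟨c, hc⟩ := IsAlgClosed.exists_root k hk
    obtain rfl := hroot c (by simp [hc.eq_zero])
    exact hsq (sq (X - C c) ▸ mul_dvd_mul_left _ (dvd_iff_isRoot.2 hc))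
  exact ((isUnit_iff_degree_eq_zero.2 hk).dvd_mul_right.1 dvd_rfl)

/-- The polynomial ring is a finite module over any subalgebra containing a nonconstant
polynomial. -/
theorem finite_of_nonconstant_mem {K : Type*} [Field K] (A : Subalgebra K K[X]) {f : K[X]}
    (hf : f ∈ A) (hdeg : 0 < f.degree) : Module.Finite A K[X] := by
  have hf0 : f ≠ 0 := by rintro rfl; simp at hdeg
  have hmonic : (f * C f.leadingCoeff⁻¹).Monic := monic_mul_leadingCoeff_inv hf0
  have hmem : f * C f.leadingCoeff⁻¹ ∈ A := A.mul_mem hf (A.algebraMap_mem _)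
  set g := f * C f.leadingCoeff⁻¹ with hg
  have hgdeg : 0 < g.degree := by rwa [hg, degree_mul_leadingCoeff_inv f hf0]
  have hint : IsIntegral A (X : K[X]) := by
    -- `X` is a root of g(T) - g, monic in T over `A`.
    refine ⟨g.map (algebraMap K A) - C ⟨g, hmem⟩,
      (hmonic.map _).sub_of_left (degree_C_le.trans_lt ?_), ?_⟩
    · rwa [hmonic.degree_map]
    · rw [eval₂_sub, eval₂_map, eval₂_C, ← IsScalarTower.algebraMap_eq K A K[X],
        algebraMap_eq, eval₂_C_X]
      exact sub_self g
  have htop : Algebra.adjoin A {(X : K[X])} = ⊤ := by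
    refine top_le_iff.1 fun p _ => ?_
    have hp : p ∈ Algebra.adjoin K {(X : K[X])} := by rw [adjoin_X]; trivial
    have hle : Algebra.adjoin K {(X : K[X])} ≤
        (Algebra.adjoin A {(X : K[X])}).restrictScalars K :=
      Algebra.adjoin_le Algebra.subset_adjoin
    exact hle hp
  have := hint.fg_adjoin_singleton
  rw [htop, Algebra.top_toSubmodule] at this
  exact ⟨this⟩

/-- If `α` is an embedding, the functions in a subalgebra containing the `α i` that vanish at `a`
generate an ideal containing `X - a`. -/
theorem IsEmbedding.X_sub_C_mem_map {α : Fin n → ℂ[X]} (h : IsEmbedding α)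
    {A : Subalgebra ℂ ℂ[X]} (hA : ∀ i, α i ∈ A) (a : ℂ) :
    X - C a ∈ (RingHom.ker ((evalRingHom a).comp (algebraMap A ℂ[X]))).map
      (algebraMap A ℂ[X]) := by
  set J := (RingHom.ker ((evalRingHom a).comp (algebraMap A ℂ[X]))).map (algebraMap A ℂ[X])
  obtain ⟨g, hg⟩ := (IsPrincipalIdealRing.principal J).principal
  have hdvd (i : Fin n) : g ∣ α i - C ((α i).eval a) := by
    have hmem : α i - C ((α i).eval a) ∈ J := by
      refine Ideal.mem_map_of_mem (algebraMap A ℂ[X])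
        (x := ⟨α i - C ((α i).eval a), A.sub_mem (hA i) (A.algebraMap_mem _)⟩) ?_
      change eval a (α i - C ((α i).eval a)) = 0
      simp
    rw [hg] at hmem
    exact Ideal.mem_span_singleton.1 hmem
  rw [hg]
  -- A root b of g gives α(b) = α(a); a double root at a gives α'(a) = 0.
  refine Ideal.mem_span_singleton.2 (dvd_X_sub_C_of_roots (fun b hb => h.1 (funext fun i => ?_))
    fun hsq => h.2 a ?_)
  · have := hb.dvd (hdvd i)
    simpa [sub_eq_zero, toMap] using this
  · rw [deriv_toMap]
    funext i
    have := pow_sub_one_dvd_derivative_of_pow_dvd (hsq.trans (hdvd i))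
    simpa [dvd_iff_isRoot] using this

theorem IsEmbedding.surjective_hat {α : Fin n → ℂ[X]} (h : IsEmbedding α) :
    Function.Surjective (hat α) := by
  let A : Subalgebra ℂ ℂ[X] := (hat α).range
  have hA (i : Fin n) : α i ∈ A := ⟨MvPolynomial.X i, by simp [hat]⟩
  obtain ⟨i, hi⟩ : ∃ i, 0 < (α i).degree := by
    by_contra! hc
    refine h.2 0 ?_
    rw [deriv_toMap]
    funext i
    rw [eq_C_of_degree_le_zero (hc i)]
    simp
  have hfin : Module.Finite A ℂ[X] := finite_of_nonconstant_mem A (hA i) hi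
  let S : Submodule A ℂ[X] := LinearMap.range (Algebra.linearMap A ℂ[X])
  -- the conductor of `A` in `ℂ[X]`
  let c : Ideal A := S.colon ⊤
  have hc : c = ⊤ := by
    by_contra hne
    obtain ⟨m, hm, hcm⟩ := Ideal.exists_le_maximal c hne
    obtain ⟨Q, hQ, rfl⟩ := Ideal.exists_ideal_over_maximal_of_isIntegral m (S := ℂ[X])
      (fun x hx => by
        have : x = 0 := Subtype.ext hx
        exact this ▸ m.zero_mem)
    obtain ⟨a, hQa⟩ : ∃ a : ℂ, Q ≤ RingHom.ker (evalRingHom a) := by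
      obtain ⟨q, rfl⟩ := (IsPrincipalIdealRing.principal Q).principal
      obtain ⟨a, ha⟩ := IsAlgClosed.exists_root q fun hq => hQ.ne_top
        (Ideal.span_singleton_eq_top.2 (isUnit_iff_degree_eq_zero.2 hq))
      exact ⟨a, (Ideal.span_singleton_le_iff_mem _).2 ha⟩
    let I : Ideal A := RingHom.ker ((evalRingHom a).comp (algebraMap A ℂ[X]))
    have hsup : (⊤ : Submodule A ℂ[X]) ≤ S ⊔ I • (⊤ : Submodule A ℂ[X]) := by
      intro p _
      obtain ⟨q, hq⟩ := X_sub_C_dvd_sub_C_eval (a := a) (p := p)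
      rw [← add_sub_cancel (C (p.eval a)) p, hq]
      refine Submodule.add_mem_sup ⟨algebraMap ℂ A (p.eval a), rfl⟩ ?_
      rw [Ideal.smul_top_eq_map]
      exact Ideal.mul_mem_right _ _ (h.X_sub_C_mem_map hA a)
    -- Nakayama: r ≡ 1 mod `I` lies in the conductor, yet the conductor vanishes at a.
    obtain ⟨r, hrI, hr⟩ :=
      Submodule.exists_sub_one_mem_and_smul_le_of_fg_of_le_sup hfin.fg_top le_rfl hsup
    have hrc : r ∈ c := Submodule.mem_colon.2 fun p _ =>
      hr (Submodule.smul_mem_pointwise_smul p r ⊤ trivial)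
    have h1 : eval a (r : ℂ[X]) = 0 := hQa (hcm hrc)
    have h2 : eval a ((r : ℂ[X]) - 1) = 0 := hrI
    simp [h1] at h2
  intro p
  have h1 : (1 : A) ∈ c := hc ▸ trivial
  obtain ⟨x, hx⟩ := Submodule.mem_colon.1 h1 p trivial
  rw [one_smul] at hx
  obtain ⟨y, hy⟩ := x.2
  exact ⟨y, hy.trans hx⟩

end PolynomialKnot

theorem mainTheorem11 (n : ℕ) (α : Fin n → Polynomial ℂ) :
    PolynomialKnot.IsEmbedding α ↔ Function.Surjective (PolynomialKnot.hat α) :=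
  ⟨fun h => h.surjective_hat, fun h =>
    ⟨PolynomialKnot.injective_toMap_of_surjective_hat h,
      PolynomialKnot.deriv_toMap_ne_zero_of_surjective_hat h⟩⟩
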